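/- Let $G$ be a group and let $A\subset G$ be a finite generating set that is closed under inversion and does not contain the identity $\epsilon$. Words are elements of the free monoid $A^*$; for $w\in A^*$ let $w^{-1}$ be its formal inverse, and write $w=_G g$ if $w$ represents $g\in G$. Let $e_{g,a}$ be the directed edge of the Cayley graph $\Gamma$ of $(G,A)$ from $g$ to $ga$ with label $a\in A$. Let $\mathcal C=\{y_g\mid g\in G\}\subseteq A^*$ be a set of normal forms (the word $y_g$ represents $g$). The edge $e_{g,a}$ is degenerate if $y_ga=y_{ga}$ or $y_g=y_{ga}a^{-1}$ as words, and recursive otherwise; let $\vec E_r$ be the set of recursive edges. Given a function $c:\vec E_r\to A^*$, let $<_c$ be the transitive closure of the relation on $\vec E_r$ in which $e'$ is related to $e$ if $e'$ lies on the path (and is directed along it) that starts at the initial vertex of $e$ and is labelled $c(e)$. A stacking for $G$ over $A$ is a pair $(\mathcal C,c)$ such that $y_\epsilon$ is the empty word, $c(e_{g,a})=_G a$ for each $e_{g,a}\in\vec E_r$, the relation $<_c$ is a strict partial order in which each $e\in\vec E_r$ has only finitely many predecessors, and $c(\vec E_r)$ is finite. Extend $c$ to a function $c'$ on all directed edges by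 $c'(e_{g,a})=a$ for degenerate edges. The stacking is algorithmic if the set $\{(w,a,c'(e_{g,a}))\mid w\in A^*,\ a\in A,\ w=_G g\}\subseteq A^*\times A\times A^*$ is recursive, and $G$ is algorithmically stackable if it has an algorithmic stacking over some such $A$. The stacking presentation is $\langle A\mid R_c\rangle$, where $R_c$ consists of the nonempty words in the closure of $\{c(e_{g,a})a^{-1}\mid e_{g,a}\in\vec E_r\}$ under inversion, cyclic conjugation and free reduction. A van Kampen diagram for $w\in A^*$ over $\langle A\mid R_c\rangle$ is a finite, planar, contractible combinatorial 2-complex with a base vertex and with edges directed and labelled by elements of $A$, such that the boundary, read counterclockwise from the base vertex, is an edge path labelled $w$, and every 2-cell has boundary labelled by an element of $R_c$. 1. If $G$ is algorithmically stackable, then $G$ has solvable word problem: $G$ is finitely generated, and for every finite generating family of $G$ the set of words in these generators and their inverses that represent the identity is recursive. 2. For every $A$ as above and every algorithmic stacking $(\mathcal C,c)$ for $G$ over $A$, there is an algorithm which, upon input of a word $w\in A^*$ that represents the identity of $G$, constructs a van Kampen diagram for $w$ over the stacking presentation $\langle A\mid R_c\rangle$. -/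

import Mathlib

open Relation

universe u

/-! ### Symmetric generating sets and words -/

/-- A finite generating set of `G`, closed under inversion, none of whose elements is trivial. -/
structure SymmGenSet (G : Type u) [Group G] where
  carrier : Finset G
  inv_mem : ∀ a ∈ carrier, a⁻¹ ∈ carrier
  one_notMem : (1 : G) ∉ carrier
  closure_eq_top : Subgroup.closure (carrier : Set G) = ⊤

/-- The generators, regarded as letters. Words are lists of letters. -/
def SymmGenSet.Letter {G : Type u} [Group G] (A : SymmGenSet G) : Type u :=
  {a : G // a ∈ A.carrier}

/-- The element of `G` represented by a letter. -/
def SymmGenSet.Letter.val {G : Type u} [Group G] {A : SymmGenSet G} (a : A.Letter) : G :=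
  Subtype.val a

/-- The letter `a⁻¹`. -/
instance SymmGenSet.instInvLetter {G : Type u} [Group G] (A : SymmGenSet G) : Inv A.Letter :=
  ⟨fun a => ⟨a.val⁻¹, A.inv_mem _ a.property⟩⟩

/-- Letters of the finite alphabet are coded by numbers through an enumeration. Which enumeration
is used is irrelevant, since every function between finite sets is computable. -/
noncomputable instance SymmGenSet.instPrimcodableLetter {G : Type u} [Group G]
    (A : SymmGenSet G) : Primcodable A.Letter :=
  Primcodable.ofEquiv (Fin A.carrier.card) A.carrier.equivFin

/-- The element of `G` represented by a word. -/
def SymmGenSet.eval {G : Type u} [Group G] (A : SymmGenSet G) (w : List A.Letter) : G :=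
  (w.map SymmGenSet.Letter.val).prod

/-- The formal inverse of a word. -/
def wordInv {α : Type u} [Inv α] (w : List α) : List α :=
  (w.map fun a => a⁻¹).reverse

/-- `FreeStep w w'`: the word `w'` arises from `w` by deleting one subword `a a⁻¹`. -/
def FreeStep {α : Type u} [Inv α] (w w' : List α) : Prop :=
  ∃ (x y : List α) (a : α), w = x ++ a :: a⁻¹ :: y ∧ w' = x ++ y

/-- `w'` is a freely reduced word, obtained from `w` by free reduction. -/
def IsFreeReductionOf {α : Type u} [Inv α] (w' w : List α) : Prop :=
  ReflTransGen FreeStep w w' ∧ ∀ z, ¬ FreeStep w' z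

/-- The closure of a set of words under inversion, cyclic conjugation and free reduction. -/
inductive SymmetrizedClosure {α : Type u} [Inv α] (R : Set (List α)) : List α → Prop
  | base (r : List α) : r ∈ R → SymmetrizedClosure R r
  | inv (r : List α) : SymmetrizedClosure R r → SymmetrizedClosure R (wordInv r)
  | rotate (x y : List α) : SymmetrizedClosure R (x ++ y) → SymmetrizedClosure R (y ++ x)
  | reduce (r s : List α) : SymmetrizedClosure R r → IsFreeReductionOf s r →
      SymmetrizedClosure R s

/-! ### Stackings -/

/-- For normal forms `y g`, the directed edge `(g, a)` of the Cayley graph, from `g` to `g a`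
with label `a`, is degenerate if `y_g a = y_{ga}` or `y_g = y_{ga} a⁻¹` as words. -/
def IsDegenerate {G : Type u} [Group G] {A : SymmGenSet G} (y : G → List A.Letter)
    (e : G × A.Letter) : Prop :=
  y e.1 ++ [e.2] = y (e.1 * e.2.val) ∨ y e.1 = y (e.1 * e.2.val) ++ [e.2⁻¹]

/-- The recursive edges: the directed edges of the Cayley graph that are not degenerate. -/
def RecursiveEdge {G : Type u} [Group G] {A : SymmGenSet G} (y : G → List A.Letter) : Type u :=
  {e : G × A.Letter // ¬ IsDegenerate y e}

/-- The directed edge `e` lies on the path in the Cayley graph that starts at `g` and is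
labelled by the word `w`. -/
def LiesOnPath {G : Type u} [Group G] {A : SymmGenSet G} (e : G × A.Letter) (g : G)
    (w : List A.Letter) : Prop :=
  ∃ (x z : List A.Letter) (b : A.Letter), w = x ++ b :: z ∧ e = (g * A.eval x, b)

/-- The relation `<_c` on recursive edges: the transitive closure of the relation
"`e'` lies on the path from the initial vertex of `e` labelled `c e`". -/
def StackingLT {G : Type u} [Group G] {A : SymmGenSet G} {y : G → List A.Letter}
    (c : RecursiveEdge y → List A.Letter) : RecursiveEdge y → RecursiveEdge y → Prop :=
  TransGen fun e' e => LiesOnPath e'.1 e.1.1 (c e)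

/-- A stacking for `G` with respect to `A`. -/
structure Stacking {G : Type u} [Group G] (A : SymmGenSet G) where
  /-- the normal form of each group element -/
  nf : G → List A.Letter
  eval_nf : ∀ g, A.eval (nf g) = g
  nf_one : nf 1 = []
  /-- the stacking map -/
  c : RecursiveEdge nf → List A.Letter
  eval_c : ∀ e, A.eval (c e) = e.1.2.val
  strictOrder : IsStrictOrder (RecursiveEdge nf) (StackingLT c)
  finite_below : ∀ e, {e' | StackingLT c e' e}.Finite
  finite_range : (Set.range c).Finite

open Classical in
/-- The extension `c'` of the stacking map to all directed edges, with `c' (g, a) = a` on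
degenerate edges. -/
noncomputable def Stacking.extendedMap {G : Type u} [Group G] {A : SymmGenSet G}
    (S : Stacking A) (e : G × A.Letter) : List A.Letter :=
  if h : IsDegenerate S.nf e then [e.2] else S.c ⟨e, h⟩

/-- The set `{(w, a, c'(e_{w,a}))}` is recursive. -/
def Stacking.IsAlgorithmic {G : Type u} [Group G] {A : SymmGenSet G} (S : Stacking A) : Prop :=
  ComputablePred fun t : List A.Letter × A.Letter × List A.Letter =>
    t.2.2 = S.extendedMap (A.eval t.1, t.2.1)

/-- The relators of the stacking presentation: the nonempty words in the closure of
`{c(e_{g,a}) a⁻¹}` under inversion, cyclic conjugation and free reduction. -/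
def Stacking.relators {G : Type u} [Group G] {A : SymmGenSet G} (S : Stacking A) :
    Set (List A.Letter) :=
  {r | r ≠ [] ∧ SymmetrizedClosure (Set.range fun e => S.c e ++ [e.1.2⁻¹]) r}

/-- `G` is algorithmically stackable. -/
def AlgorithmicallyStackable (G : Type u) [Group G] : Prop :=
  ∃ (A : SymmGenSet G) (S : Stacking A), S.IsAlgorithmic

/-- `G` is finitely generated, and for every finite generating family the set of words in the
generators and their inverses that represent the identity is recursive. -/
def HasSolvableWordProblem (G : Type u) [Group G] : Prop :=
  Group.FG G ∧ ∀ (n : ℕ) (g : Fin n → G), Subgroup.closure (Set.range g) = ⊤ →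
    ComputablePred fun w : List (Fin n × Bool) =>
      (w.map fun p => if p.2 then g p.1 else (g p.1)⁻¹).prod = 1

/-! ### Van Kampen diagrams -/

/-- Combinatorial data of a finite plane 2-complex with directed edges labelled by `α`.
The vertices are `0, …, numVertices - 1`; the `i`-th edge is listed as
(initial vertex, label, terminal vertex). A pair `(i, true)` stands for the `i`-th edge traversed
forwards and `(i, false)` for the same edge traversed backwards. A 2-cell is given by its
boundary circuit. -/
structure Diagram (α : Type u) where
  numVertices : ℕ
  base : ℕ
  edges : List (ℕ × α × ℕ)
  cells : List (List (ℕ × Bool))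
  boundary : List (ℕ × Bool)

/-- A diagram is the tuple of its components. -/
def Diagram.equivTuple (α : Type u) : Diagram α ≃
    ℕ × ℕ × List (ℕ × α × ℕ) × List (List (ℕ × Bool)) × List (ℕ × Bool) where
  toFun D := (D.numVertices, D.base, D.edges, D.cells, D.boundary)
  invFun t := ⟨t.1, t.2.1, t.2.2.1, t.2.2.2.1, t.2.2.2.2⟩
  left_inv _ := rfl
  right_inv _ := rfl

instance Diagram.instPrimcodable (α : Type u) [Primcodable α] : Primcodable (Diagram α) :=
  Primcodable.ofEquiv _ (Diagram.equivTuple α)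

/-- (initial vertex, label, terminal vertex) of an oriented edge; the edge labelled `a`,
traversed backwards, reads `a⁻¹`. It is `none` if there is no such edge. -/
def Diagram.dart {α : Type u} [Inv α] (D : Diagram α) (d : ℕ × Bool) : Option (ℕ × α × ℕ) :=
  if d.2 then D.edges[d.1]? else D.edges[d.1]?.map fun e => (e.2.2, e.2.1⁻¹, e.1)

/-- The list `p` consists of oriented edges of `D`, and its labels spell the word `w`. -/
def Diagram.Reads {α : Type u} [Inv α] (D : Diagram α) (p : List (ℕ × Bool)) (w : List α) :
    Prop :=
  p.map (fun d => (D.dart d).map fun e => e.2.1) = w.map some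

/-- `y` follows `x` in the cyclic list `p`. -/
def CyclicNext {β : Type*} (p : List β) (x y : β) : Prop :=
  [x, y] <:+: p ++ p.take 1

/-- In the cyclic list `p`, every oriented edge ends where its successor starts. -/
def Diagram.IsCircuit {α : Type u} [Inv α] (D : Diagram α) (p : List (ℕ × Bool)) : Prop :=
  ∀ d d', CyclicNext p d d' →
    (D.dart d).map (fun e => e.2.2) = (D.dart d').map (fun e => e.1)

/-- `d` and `d'` issue from a common vertex and bound a corner of a 2-cell or of the outer
region: `d'` is traversed immediately after the reverse of `d`. -/
def Diagram.Corner {α : Type u} (D : Diagram α) (d d' : ℕ × Bool) : Prop :=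
  ∃ p ∈ D.boundary :: D.cells, CyclicNext p (d.1, !d.2) d'

/-- `D` is a van Kampen diagram for the word `w` with respect to the set `R` of relators: a
finite, planar, contractible 2-complex whose boundary reads `w` from the base vertex and all of
whose 2-cells read words in `R`.

The 2-cells are traversed clockwise and the boundary counterclockwise, so that each region
(2-cell or outer region) lies to the right of its circuit. The data describe a closed oriented
surface, cellulated by the 2-cells and the outer region: each oriented edge is traversed exactly
once (`sides`), and the corners at each vertex form a single cycle (`links`). By connectedness
and by Euler's formula this surface is a sphere, and the complement of the open outer region is
a planar contractible complex; every such complex arises in this way. -/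
structure Diagram.IsVanKampen {α : Type u} [Inv α] (D : Diagram α) (R : Set (List α))
    (w : List α) : Prop where
  base_lt : D.base < D.numVertices
  endpoints_lt : ∀ e ∈ D.edges, e.1 < D.numVertices ∧ e.2.2 < D.numVertices
  connected : ∀ v < D.numVertices,
    ReflTransGen (fun s t => ∃ d a, D.dart d = some (s, a, t)) D.base v
  cells_ne_nil : ∀ p ∈ D.cells, p ≠ []
  cells_circuit : ∀ p ∈ D.cells, D.IsCircuit p
  cells_label : ∀ p ∈ D.cells, ∃ r ∈ R, D.Reads p r
  boundary_circuit : D.IsCircuit D.boundary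
  boundary_base : ∀ d ∈ D.boundary.head?, (D.dart d).map (fun e => e.1) = some D.base
  boundary_label : D.Reads D.boundary w
  sides : ∀ d : ℕ × Bool, d.1 < D.edges.length → (D.boundary ++ D.cells.flatten).count d = 1
  links : ∀ d d' v a a' t t', D.dart d = some (v, a, t) → D.dart d' = some (v, a', t') →
    EqvGen D.Corner d d'
  euler : D.numVertices + D.cells.length = D.edges.length + 1

/-! ### Cyclic chains of oriented edges -/

/-! A word `w` is brought to normal form by following its path in the Cayley graph while keeping the
normal form of the vertex reached. At a degenerate edge the next letter is appended to this normal
form or cancels its last letter; at a recursive edge `e` the letter is replaced by `c e`, which is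
read next. Since `<_c` is well-founded, every edge is crossed after finitely many steps
(`exists_run_edge`), and the procedure ends with the normal form of `w`, which is empty iff `w`
represents the identity. The choice between appending and cancelling is forced because normal forms
are closed under prefixes (`nf_eval_of_append_eq`). A step needs only the value of `c'`, which is
computable because its graph is recursive. Hence the word problem is solvable
(`computable_finalState`). For the diagram, the recorded steps are undone, starting from a single
point. Undoing a cancellation attaches a spur to the boundary (`addSpur`); undoing a replacement of
`a` by `c e` glues a cell with label `c e` followed by `a⁻¹` along a boundary segment (`addChord`).
Both preserve `IsVanKampen`, so a word reduced to the empty word acquires a diagram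
(`Run.exists_isVanKampen`). -/

theorem forall_cyclicNext_iff {β : Type*} {R : β → β → Prop} {p : List β} :
    (∀ a b, CyclicNext p a b → R a b) ↔ Cycle.Chain R (p : Cycle β) := by
  have key : ∀ l : List β, (∀ a b, [a, b] <:+: l → R a b) ↔ l.IsChain R := fun l => by
    rw [List.isChain_iff_forall_rel_of_append_cons_cons]
    constructor
    · rintro h a b l₁ l₂ rfl
      exact h a b ⟨l₁, l₂, by simp⟩
    · rintro h a b ⟨l₁, l₂, rfl⟩
      exact @h a b l₁ l₂ (by simp)
  cases p with
  | nil => simp [CyclicNext]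
  | cons a l => exact (key _).trans (by simp [Cycle.chain_coe_cons])

/-- Circuits have no preferred first edge; rotating them brings the place of an insertion to the
front. -/
theorem Cycle.coe_append_comm {β : Type*} (x y : List β) :
    ((x ++ y : List β) : Cycle β) = (y ++ x : List β) :=
  Cycle.coe_eq_coe.2 List.isRotated_append

theorem Cycle.Chain.rel_getLast_head {β : Type*} {R : β → β → Prop} {l : List β}
    (h : Cycle.Chain R (l : Cycle β)) {a b : β} (ha : a ∈ l.getLast?) (hb : b ∈ l.head?) :
    R a b := by
  cases l with
  | nil => simp at ha
  | cons c l =>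
    obtain rfl : c = b := by simpa using hb
    rcases List.eq_nil_or_concat' l with rfl | ⟨l, d, rfl⟩
    · obtain rfl : c = a := by simpa using ha
      simpa [Cycle.chain_coe_cons] using h
    · rw [← List.cons_append, List.getLast?_concat, Option.mem_def, Option.some.injEq] at ha
      subst ha
      rw [Cycle.chain_coe_cons, ← List.cons_append, ← List.cons_append,
        List.append_assoc, List.isChain_append] at h
      simpa using h.2.1

/-- The reverse of an oriented edge. -/
def flipDart (d : ℕ × Bool) : ℕ × Bool := (d.1, !d.2)

/-- `Turn E p q`: a path may turn from `p` to `q`, where `E` relates oriented edges issuing from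
the same point. -/
def Turn (E : ℕ × Bool → ℕ × Bool → Prop) (p q : ℕ × Bool) : Prop := E (flipDart p) q

section Turn

variable {E : ℕ × Bool → ℕ × Bool → Prop} {n : ℕ}

theorem isChain_turn_concat {l : List (ℕ × Bool)} {p q : ℕ × Bool}
    (hE : Equivalence E) (hpq : E p q) :
    (l ++ [p]).IsChain (Turn E) ↔ (l ++ [q]).IsChain (Turn E) := by
  simp only [List.isChain_append, List.isChain_singleton, true_and, List.head?_cons,
    Option.mem_def, Option.some.injEq, forall_eq', Turn]
  exact and_congr_right fun _ => forall₂_congr fun a _ =>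
    ⟨fun h => hE.trans h hpq, fun h => hE.trans h (hE.symm hpq)⟩

theorem isChain_turn_cons {l : List (ℕ × Bool)} {p q : ℕ × Bool}
    (hE : Equivalence E) (hpq : E (flipDart p) (flipDart q)) :
    (p :: l).IsChain (Turn E) ↔ (q :: l).IsChain (Turn E) := by
  cases l with
  | nil => simp
  | cons a l =>
    simp only [List.isChain_cons_cons, Turn]
    exact and_congr_left fun _ => ⟨fun h => hE.trans (hE.symm hpq) h, fun h => hE.trans hpq h⟩

/-- Cutting a region along a chord. -/
theorem chain_turn_chord (hE : Equivalence E) (a b : ℕ × Bool) (v z : List (ℕ × Bool))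
    (hv : v.head? = some a) (hv' : v.getLast? = some b) :
    (Cycle.Chain (Turn E) ((n, true) :: z : List (ℕ × Bool)) ∧
      Cycle.Chain (Turn E) (v ++ [(n, false)] : List (ℕ × Bool))) ↔
    E (n, true) a ∧ E (n, false) (flipDart b) ∧
      Cycle.Chain (Turn E) (v ++ z : List (ℕ × Bool)) := by
  obtain ⟨v, rfl⟩ : ∃ l, v = a :: l := by
    cases v with
    | nil => simp at hv
    | cons c l => exact ⟨l, by simpa using hv⟩
  obtain ⟨l, hl⟩ : ∃ l, a :: v = l ++ [b] := by
    rcases List.eq_nil_or_concat (a :: v) with h | ⟨l, d, h⟩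
    · simp at h
    · exact ⟨l, by rw [h] at hv' ⊢; simpa using hv'⟩
  have hcell : Cycle.Chain (Turn E) (a :: v ++ [(n, false)] : List (ℕ × Bool)) ↔
      (a :: v).IsChain (Turn E) ∧ E (flipDart b) (n, false) ∧ E (n, true) a := by
    rw [List.cons_append, Cycle.chain_coe_cons, ← List.cons_append, ← List.cons_append, hl]
    simp only [List.isChain_append, Turn, flipDart, List.isChain_singleton, List.getLast?_concat,
      Option.mem_def, Option.some.injEq, List.head?_cons, forall_eq', true_and, Bool.not_false]
    tauto
  have hsplit : Cycle.Chain (Turn E) (a :: v ++ z : List (ℕ × Bool)) ↔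
      (a :: v).IsChain (Turn E) ∧ (b :: (z ++ [a])).IsChain (Turn E) := by
    rw [List.cons_append, Cycle.chain_coe_cons, ← List.cons_append, ← List.cons_append, hl]
    rw [List.append_assoc, List.append_assoc, List.singleton_append, List.isChain_split]
  rw [hcell, hsplit, Cycle.chain_coe_cons]
  -- Seen from the rest `z` of the cycle, the new edge behaves like the path `v`: it starts like the
  -- first edge `a` and ends like the last edge `b`.
  have hmove (h₁ : E (n, true) a) (h₂ : E (flipDart b) (n, false)) :
      ((n, true) :: (z ++ [(n, true)])).IsChain (Turn E) ↔
        (b :: (z ++ [a])).IsChain (Turn E) := by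
    rw [isChain_turn_cons hE (hE.symm h₂ : E (flipDart (n, true)) (flipDart b)),
      ← List.cons_append, ← List.cons_append, isChain_turn_concat hE h₁]
  constructor
  · rintro ⟨h, h₁, h₂, h₃⟩
    exact ⟨h₃, hE.symm h₂, h₁, (hmove h₃ h₂).1 h⟩
  · rintro ⟨h₃, h₂, h₁, h⟩
    exact ⟨(hmove h₃ (hE.symm h₂)).2 h, h₁, hE.symm h₂, h₃⟩

/-- Attaching a spur to a region. -/
theorem chain_turn_spur (hE : Equivalence E) (hn : E (n, false) (n, false))
    (z : List (ℕ × Bool)) :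
    Cycle.Chain (Turn E) ((n, true) :: (n, false) :: z : List (ℕ × Bool)) ↔
    (∀ a ∈ z.head?, E (n, true) a) ∧ Cycle.Chain (Turn E) (z : Cycle (ℕ × Bool)) := by
  rw [Cycle.chain_coe_cons]
  cases z with
  | nil => simp [Turn, flipDart, hE.refl]
  | cons a z =>
    rw [Cycle.chain_coe_cons]
    simp only [List.cons_append, List.isChain_cons_cons, List.head?_cons, Option.mem_def,
      Option.some.injEq, forall_eq']
    constructor
    · rintro ⟨-, h, h'⟩
      have h : E (n, true) a := h
      exact ⟨h, by rwa [← List.cons_append, ← isChain_turn_concat hE h]⟩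
    · rintro ⟨h, h'⟩
      exact ⟨hn, h, by rwa [← List.cons_append, isChain_turn_concat hE h]⟩

end Turn

/-! ### Enlarging diagrams -/

namespace Diagram

variable {α : Type u}

/-- Puts corners into the form that `isCircuit_iff` gives to circuits, so that `chain_turn_chord`
and `chain_turn_spur` serve twice. With equality of initial vertices for `E`, read from right to
left, they close the new circuits. With the equivalence generated by the new corners, read from left
to right, they recover the old corners. -/
theorem corner_le_iff {D : Diagram α} {E : ℕ × Bool → ℕ × Bool → Prop} :
    (∀ d d', D.Corner d d' → E d d') ↔
      ∀ p ∈ D.boundary :: D.cells, Cycle.Chain (Turn E) (p : Cycle _) := by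
  simp only [← forall_cyclicNext_iff, Corner, Turn, flipDart]
  constructor
  · intro h p hp a b hab
    exact h _ _ ⟨p, hp, by simpa using hab⟩
  · rintro h d d' ⟨p, hp, hd⟩
    simpa using h p hp _ _ hd

theorem chain_eqvGen_corner (D : Diagram α) {p : List (ℕ × Bool)}
    (hp : p ∈ D.boundary :: D.cells) : Cycle.Chain (Turn (EqvGen D.Corner)) (p : Cycle _) :=
  corner_le_iff.1 (fun d d' h => EqvGen.rel d d' h) p hp

variable [Inv α]

/-- The initial vertex of an oriented edge. -/
def start (D : Diagram α) (d : ℕ × Bool) : Option ℕ := (D.dart d).map fun e => e.1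

/-- The `i`-th vertex on the boundary. -/
def boundaryVertex (D : Diagram α) (i : ℕ) : ℕ := ((D.boundary[i]?).bind D.start).getD D.base

/-- The diagram consisting of one vertex. -/
def point (α : Type u) : Diagram α := ⟨1, 0, [], [], []⟩

/-- Attach an edge labelled `a` with a new terminal vertex at the `i`-th boundary vertex. -/
def addSpur (D : Diagram α) (i : ℕ) (a : α) : Diagram α where
  numVertices := D.numVertices + 1
  base := D.base
  edges := D.edges ++ [(D.boundaryVertex i, a, D.numVertices)]
  cells := D.cells
  boundary := D.boundary.take i ++ (D.edges.length, true) :: (D.edges.length, false) ::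
    D.boundary.drop i

/-- Attach a cell along `k` consecutive boundary edges, starting at the `i`-th boundary vertex.
Its boundary is completed by a new edge labelled `a`. -/
def addChord (D : Diagram α) (i k : ℕ) (a : α) : Diagram α where
  numVertices := D.numVertices
  base := D.base
  edges := D.edges ++ [(D.boundaryVertex i, a, D.boundaryVertex (i + k))]
  cells := ((D.boundary.drop i).take k ++ [(D.edges.length, false)]) :: D.cells
  boundary := D.boundary.take i ++ (D.edges.length, true) :: D.boundary.drop (i + k)

theorem map_end_dart (D : Diagram α) (d : ℕ × Bool) :
    (D.dart d).map (fun e => e.2.2) = D.start (flipDart d) := by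
  obtain ⟨i, b⟩ := d
  cases b <;> simp [start, dart, flipDart, Function.comp_def]

theorem isCircuit_iff {D : Diagram α} {p : List (ℕ × Bool)} :
    D.IsCircuit p ↔ Cycle.Chain (Turn fun d d' => D.start d = D.start d') (p : Cycle _) := by
  rw [← forall_cyclicNext_iff]
  simp only [IsCircuit, map_end_dart, Turn]
  rfl

theorem isSome_dart_iff {D : Diagram α} {d : ℕ × Bool} :
    (D.dart d).isSome ↔ d.1 < D.edges.length := by
  obtain ⟨i, b⟩ := d
  cases b <;> simp [dart]

theorem lt_of_dart_eq_some {D : Diagram α} {d : ℕ × Bool} {e : ℕ × α × ℕ}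
    (h : D.dart d = some e) : d.1 < D.edges.length :=
  isSome_dart_iff.1 (by simp [h])

theorem Reads.lt {D : Diagram α} {p : List (ℕ × Bool)} {w : List α} (h : D.Reads p w)
    {d : ℕ × Bool} (hd : d ∈ p) : d.1 < D.edges.length := by
  have h1 : (D.dart d).map (fun e => e.2.1) ∈ w.map some := by
    rw [← h]
    exact List.mem_map_of_mem hd
  obtain ⟨a, -, ha⟩ := List.mem_map.1 h1
  rw [← isSome_dart_iff, ← Option.isSome_map (f := fun e => e.2.1), ← ha]
  rfl

end Diagram

namespace Diagram

variable {α : Type u} [Inv α]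

/-- Both enlargements append one edge at the end of the list, so old indices keep their meaning. -/
theorem dart_of_edges_eq {D D' : Diagram α} {e : ℕ × α × ℕ} (h : D'.edges = D.edges ++ [e])
    {d : ℕ × Bool} (hd : d.1 < D.edges.length) : D'.dart d = D.dart d := by
  simp [dart, h, List.getElem?_append_left hd]

theorem dart_new_true {D D' : Diagram α} {e : ℕ × α × ℕ} (h : D'.edges = D.edges ++ [e]) :
    D'.dart (D.edges.length, true) = some e := by
  simp [dart, h]

theorem dart_new_false {D D' : Diagram α} {e : ℕ × α × ℕ} (h : D'.edges = D.edges ++ [e]) :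
    D'.dart (D.edges.length, false) = some (e.2.2, e.2.1⁻¹, e.1) := by
  simp [dart, h]

theorem start_of_edges_eq {D D' : Diagram α} {e : ℕ × α × ℕ} (h : D'.edges = D.edges ++ [e])
    {d : ℕ × Bool} (hd : d.1 < D.edges.length) : D'.start d = D.start d := by
  rw [start, dart_of_edges_eq h hd, start]

theorem Reads.of_edges_eq {D D' : Diagram α} {e : ℕ × α × ℕ} (h : D'.edges = D.edges ++ [e])
    {p : List (ℕ × Bool)} {w : List α} (hp : D.Reads p w) : D'.Reads p w := by
  rw [Reads, ← hp]
  exact List.map_congr_left fun d hd => by rw [dart_of_edges_eq h (hp.lt hd)]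

theorem equivalence_start_eq (D : Diagram α) :
    Equivalence fun d d' => D.start d = D.start d' :=
  ⟨fun _ => rfl, fun h => h.symm, fun h h' => h.trans h'⟩

theorem Reads.append {D : Diagram α} {p q : List (ℕ × Bool)} {w z : List α}
    (hp : D.Reads p w) (hq : D.Reads q z) : D.Reads (p ++ q) (w ++ z) := by
  rw [Reads, List.map_append, List.map_append, hp, hq]

theorem Reads.length_eq {D : Diagram α} {p : List (ℕ × Bool)} {w : List α}
    (hp : D.Reads p w) : p.length = w.length := by
  simpa using congrArg List.length hp

theorem Reads.exists_append {D : Diagram α} {p : List (ℕ × Bool)} {w z : List α}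
    (hp : D.Reads p (w ++ z)) : ∃ q r, p = q ++ r ∧ D.Reads q w ∧ D.Reads r z := by
  rw [Reads, List.map_append, List.map_eq_append_iff] at hp
  exact hp

theorem IsCircuit.of_edges_eq {D D' : Diagram α} {e : ℕ × α × ℕ}
    (h : D'.edges = D.edges ++ [e]) {p : List (ℕ × Bool)} (hp : D.IsCircuit p)
    (hlt : ∀ d ∈ p, d.1 < D.edges.length) : D'.IsCircuit p := by
  intro d d' hd
  have hsub := List.IsInfix.subset hd
  have hmem : ∀ c ∈ [d, d'], c ∈ p := fun c hc => by
    rcases List.mem_append.1 (hsub hc) with h | h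
    · exact h
    · exact List.mem_of_mem_take h
  rw [dart_of_edges_eq h (hlt d (hmem d (by simp))),
    dart_of_edges_eq h (hlt d' (hmem d' (by simp)))]
  exact hp d d' hd

theorem start_eq_some_iff {D : Diagram α} {d : ℕ × Bool} {v : ℕ} :
    D.start d = some v ↔ ∃ a t, D.dart d = some (v, a, t) := by
  simp [start]

theorem lt_of_start_eq_some {D : Diagram α} {d : ℕ × Bool} {v : ℕ} (h : D.start d = some v) :
    d.1 < D.edges.length := by
  obtain ⟨a, t, h⟩ := start_eq_some_iff.1 h
  exact lt_of_dart_eq_some h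

theorem mem_edges_of_dart {D : Diagram α} {d : ℕ × Bool} {s t : ℕ} {a : α}
    (h : D.dart d = some (s, a, t)) : ∃ b, (s, b, t) ∈ D.edges ∨ (t, b, s) ∈ D.edges := by
  obtain ⟨i, _ | _⟩ := d
  · simp only [dart, Bool.false_eq_true, if_false, Option.map_eq_some_iff, Prod.mk.injEq] at h
    obtain ⟨⟨t', b, s'⟩, h, rfl, -, rfl⟩ := h
    exact ⟨b, Or.inr (List.mem_of_getElem? h)⟩
  · exact ⟨a, Or.inl (List.mem_of_getElem? (by simpa [dart] using h))⟩

/-! ### Van Kampen diagrams cut open at a boundary vertex, and their enlargements. -/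

namespace IsVanKampen

variable {D : Diagram α} {R : Set (List α)} {w : List α}

theorem start_lt (hD : D.IsVanKampen R w) {d : ℕ × Bool} {v : ℕ} (h : D.start d = some v) :
    v < D.numVertices := by
  obtain ⟨a, t, h⟩ := start_eq_some_iff.1 h
  obtain ⟨b, h | h⟩ := mem_edges_of_dart h
  · exact (hD.endpoints_lt _ h).1
  · exact (hD.endpoints_lt _ h).2

/-- The rotated list `y ++ x` is the boundary read from the cut, which treats a cut at the very end
like any other. -/
theorem start_head (hD : D.IsVanKampen R w) {x y : List (ℕ × Bool)} (h : D.boundary = x ++ y) :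
    ∀ d ∈ (y ++ x).head?, D.start d = some (D.boundaryVertex x.length) := by
  intro d hd
  cases y with
  | nil =>
    -- Past the last boundary edge `boundaryVertex` takes its default value, the base, where the
    -- boundary closes up.
    have h1 : D.start d = some D.base := hD.boundary_base d (by simpa [h] using hd)
    simpa [boundaryVertex, h] using h1
  | cons c y =>
    obtain rfl : c = d := by simpa using hd
    have hc : c.1 < D.edges.length := hD.boundary_label.lt (by simp [h])
    rw [← isSome_dart_iff, Option.isSome_iff_exists] at hc
    obtain ⟨e, he⟩ := hc
    simp [boundaryVertex, h, start, he]

theorem chain_boundary (hD : D.IsVanKampen R w) {x y : List (ℕ × Bool)}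
    (h : D.boundary = x ++ y) :
    Cycle.Chain (Turn fun d d' => D.start d = D.start d') (y ++ x : List (ℕ × Bool)) := by
  rw [← Cycle.coe_append_comm, ← h, ← isCircuit_iff]
  exact hD.boundary_circuit

theorem start_getLast (hD : D.IsVanKampen R w) {x y : List (ℕ × Bool)}
    (h : D.boundary = x ++ y) :
    ∀ d ∈ (y ++ x).getLast?, D.start (flipDart d) = some (D.boundaryVertex x.length) := by
  intro d hd
  obtain ⟨c, hc⟩ : ∃ c, (y ++ x).head? = some c := by
    cases hyx : y ++ x with
    | nil => simp [hyx] at hd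
    | cons c l => exact ⟨c, rfl⟩
  rw [← hD.start_head h c hc]
  exact (hD.chain_boundary h).rel_getLast_head hd hc

theorem boundaryVertex_lt (hD : D.IsVanKampen R w) {x y : List (ℕ × Bool)}
    (h : D.boundary = x ++ y) : D.boundaryVertex x.length < D.numVertices := by
  cases hyx : y ++ x with
  | nil =>
    obtain ⟨rfl, rfl⟩ := List.append_eq_nil_iff.1 hyx
    simpa [boundaryVertex, h] using hD.base_lt
  | cons c l => exact hD.start_lt (hD.start_head h c (by simp [hyx]))

theorem cells_lt (hD : D.IsVanKampen R w) {p : List (ℕ × Bool)} (hp : p ∈ D.cells)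
    {d : ℕ × Bool} (hd : d ∈ p) : d.1 < D.edges.length := by
  obtain ⟨r, -, hr⟩ := hD.cells_label p hp
  exact hr.lt hd

theorem count_eq_zero (hD : D.IsVanKampen R w) (b : Bool) :
    (D.boundary ++ D.cells.flatten).count (D.edges.length, b) = 0 := by
  rw [List.count_eq_zero]
  intro h
  have : (D.edges.length, b).1 < D.edges.length := by
    rcases List.mem_append.1 h with h | h
    · exact hD.boundary_label.lt h
    · obtain ⟨p, hp, hd⟩ := List.mem_flatten.1 h
      exact hD.cells_lt hp hd
  exact lt_irrefl _ this

/-- In both enlargements the regions traverse the old oriented edges as before, and the two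
orientations of the new edge in addition. -/
theorem count_of_perm (hD : D.IsVanKampen R w) {l : List (ℕ × Bool)}
    (hl : l.Perm ((D.edges.length, true) :: (D.edges.length, false) ::
      (D.boundary ++ D.cells.flatten))) {d : ℕ × Bool} (hd : d.1 < D.edges.length + 1) :
    l.count d = 1 := by
  obtain ⟨i, b⟩ := d
  rw [hl.count_eq, List.count_cons, List.count_cons]
  rcases Nat.lt_succ_iff_lt_or_eq.1 hd with h | h
  · have h : i < D.edges.length := h
    rw [hD.sides _ h]
    simp [h.ne']
  · obtain rfl : i = D.edges.length := h
    rw [hD.count_eq_zero]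
    cases b <;> simp

theorem connected_of_edges_eq (hD : D.IsVanKampen R w) {D' : Diagram α} {e : ℕ × α × ℕ}
    (h : D'.edges = D.edges ++ [e]) (hbase : D'.base = D.base) {v : ℕ} (hv : v < D.numVertices) :
    ReflTransGen (fun s t => ∃ d a, D'.dart d = some (s, a, t)) D'.base v := by
  rw [hbase]
  refine ReflTransGen.mono ?_ _ _ (hD.connected v hv)
  rintro s t ⟨d, a, hd⟩
  exact ⟨d, a, by rw [dart_of_edges_eq h (lt_of_dart_eq_some hd), hd]⟩

/-- Transfers the old link condition: the corner relation of `D` generates the least equivalence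
containing it, so any `E` containing the old corners relates oriented edges with a common origin. -/
theorem eqvGen_of_start_eq (hD : D.IsVanKampen R w) {E : ℕ × Bool → ℕ × Bool → Prop}
    (hE : Equivalence E) (hc : ∀ d d', D.Corner d d' → E d d') {d d' : ℕ × Bool} {v : ℕ}
    (h : D.start d = some v) (h' : D.start d' = some v) : E d d' := by
  obtain ⟨a, t, h⟩ := start_eq_some_iff.1 h
  obtain ⟨a', t', h'⟩ := start_eq_some_iff.1 h'
  have := EqvGen.mono hc _ _ (hD.links d d' v a a' t t' h h')
  exact (hE.eqvGen_iff).1 this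

/-- The chord splits the outer region in two. The part bounded by `v` and the reversed chord becomes
the cell, which takes over the sides of `v` with their direction. One edge and one cell are added,
so Euler's formula persists. -/
theorem addChord (hD : D.IsVanKampen R w) {wx wv wy : List α} {a : α} (hw : w = wx ++ wv ++ wy)
    (hv : wv ≠ []) (hr : wv ++ [a⁻¹] ∈ R) :
    (D.addChord wx.length wv.length a).IsVanKampen R (wx ++ a :: wy) := by
  subst hw
  obtain ⟨xv, y, hb, hxv, hy⟩ := hD.boundary_label.exists_append
  obtain ⟨x, v, rfl, hx, hv'⟩ := hxv.exists_append
  have hvne : v ≠ [] := by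
    rintro rfl
    exact hv (List.length_eq_zero_iff.1 hv'.length_eq.symm)
  rw [← hx.length_eq, ← hv'.length_eq]
  set D' := D.addChord x.length v.length a with hD'
  set n := D.edges.length with hn
  have hbx : D.boundary = x ++ (v ++ y) := by rw [hb, List.append_assoc]
  have hb' : D'.boundary = x ++ (n, true) :: y := by
    simp only [hD', Diagram.addChord, hb]
    congr 1
    · simp
    · simp [hn]
  have hc' : D'.cells = (v ++ [(n, false)]) :: D.cells := by
    simp only [hD', Diagram.addChord, hb]
    simp [hn]
  have he : D'.edges = D.edges ++
      [(D.boundaryVertex x.length, a, D.boundaryVertex (x ++ v).length)] := by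
    rw [List.length_append]; rfl
  obtain ⟨f, hf⟩ : ∃ f, v.head? = some f := by
    cases v with
    | nil => exact absurd rfl hvne
    | cons f l => exact ⟨f, rfl⟩
  obtain ⟨l, hl⟩ : ∃ l, v.getLast? = some l := ⟨_, List.getLast?_eq_getLast_of_ne_nil hvne⟩
  have hfn : f.1 < n := hv'.lt (List.mem_of_mem_head? hf)
  have hln : l.1 < n := hv'.lt (List.mem_of_mem_getLast? hl)
  have hsf : D.start f = some (D.boundaryVertex x.length) :=
    hD.start_head hbx f (by simp [hf])
  have hsl : D.start (flipDart l) = some (D.boundaryVertex (x ++ v).length) :=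
    hD.start_getLast hb l (by simp [hl])
  have hdt := dart_new_true he
  have hdn := dart_new_false he
  rw [← hn] at hdt hdn
  have hst : D'.start (n, true) = some (D.boundaryVertex x.length) := by
    rw [start, hdt]; rfl
  have hsn : D'.start (n, false) = some (D.boundaryVertex (x ++ v).length) := by
    rw [start, hdn]; rfl
  have hcirc : D'.IsCircuit (x ++ (n, true) :: y) ∧ D'.IsCircuit (v ++ [(n, false)]) := by
    rw [isCircuit_iff, isCircuit_iff, Cycle.coe_append_comm x]
    refine (chain_turn_chord D'.equivalence_start_eq f l v
      (y ++ x) hf hl).2 ⟨?_, ?_, ?_⟩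
    · rw [hst, start_of_edges_eq he hfn, hsf]
    · rw [hsn, start_of_edges_eq (d := flipDart l) he hln, hsl]
    · rw [← List.append_assoc, ← Cycle.coe_append_comm x, ← hbx, ← isCircuit_iff]
      exact hD.boundary_circuit.of_edges_eq he fun d hd => hD.boundary_label.lt hd
  have hE : Equivalence (EqvGen D'.Corner) := EqvGen.is_equivalence _
  have hchain := (chain_turn_chord hE f l v (y ++ x) hf hl).1
    ⟨by
      have := D'.chain_eqvGen_corner (p := D'.boundary) (by simp)
      rwa [hb', Cycle.coe_append_comm] at this,
     D'.chain_eqvGen_corner (by simp [hc'])⟩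
  have hcorner : ∀ d d', D.Corner d d' → EqvGen D'.Corner d d' := by
    refine corner_le_iff.2 fun p hp => ?_
    rcases List.mem_cons.1 hp with rfl | hp
    · rw [hbx, Cycle.coe_append_comm, List.append_assoc]
      exact hchain.2.2
    · exact D'.chain_eqvGen_corner (by simp [hc', hp])
  -- The ends of the chord join existing corner cycles: `(n, true)` that of the first edge `f` of
  -- `v`, and `(n, false)` that of the reverse of its last edge `l`.
  have hold : ∀ d v, D'.start d = some v →
      ∃ d₀, D.start d₀ = some v ∧ EqvGen D'.Corner d d₀ := by
    rintro ⟨i, b⟩ v hd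
    have hi := lt_of_start_eq_some hd
    simp only [he, List.length_append, List.length_singleton] at hi
    rcases Nat.lt_succ_iff_lt_or_eq.1 hi with hi | rfl
    · exact ⟨_, by rwa [start_of_edges_eq he hi] at hd, hE.refl _⟩
    · cases b with
      | true => exact ⟨f, by rw [hsf, ← hd, ← hst], hchain.1⟩
      | false => exact ⟨flipDart l, by rw [hsl, ← hd, ← hsn], hchain.2.1⟩
  have hlen : D'.edges.length = n + 1 := by simp [he, hn]
  have hread : D'.Reads [(n, true)] [a] := by simp [Reads, hdt]
  have hread' : D'.Reads [(n, false)] [a⁻¹] := by simp [Reads, hdn]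
  exact
  { base_lt := hD.base_lt
    endpoints_lt := by
      intro e h
      rw [he, List.mem_append, List.mem_singleton] at h
      rcases h with h | rfl
      · exact hD.endpoints_lt e h
      · exact ⟨hD.boundaryVertex_lt hbx, hD.boundaryVertex_lt hb⟩
    connected := fun v hv => hD.connected_of_edges_eq he rfl hv
    cells_ne_nil := by
      intro p hp
      rw [hc', List.mem_cons] at hp
      rcases hp with rfl | hp
      · simp
      · exact hD.cells_ne_nil p hp
    cells_circuit := by
      intro p hp
      rw [hc', List.mem_cons] at hp
      rcases hp with rfl | hp
      · exact hcirc.2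
      · exact (hD.cells_circuit p hp).of_edges_eq he fun d hd => hD.cells_lt hp hd
    cells_label := by
      intro p hp
      rw [hc', List.mem_cons] at hp
      rcases hp with rfl | hp
      · exact ⟨_, hr, (hv'.of_edges_eq he).append hread'⟩
      · obtain ⟨r, hr, hp⟩ := hD.cells_label p hp
        exact ⟨r, hr, hp.of_edges_eq he⟩
    boundary_circuit := hb' ▸ hcirc.1
    boundary_base := by
      intro d hd
      change D'.start d = some D.base
      rw [hb'] at hd
      cases x with
      | nil =>
        obtain rfl : (n, true) = d := by simpa using hd
        rw [hst, ← hsf]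
        exact hD.boundary_base f (by simp [hb, hf])
      | cons c x =>
        obtain rfl : c = d := by simpa using hd
        rw [start_of_edges_eq he (hx.lt (by simp))]
        exact hD.boundary_base c (by simp [hb])
    boundary_label := by
      rw [hb']
      exact (hx.of_edges_eq he).append (hread.append (hy.of_edges_eq he))
    sides := by
      intro d hd
      rw [hlen] at hd
      refine hD.count_of_perm ?_ hd
      rw [hb', hc', hb, List.perm_iff_count]
      intro c
      simp only [List.count_append, List.count_cons, List.flatten_cons, List.count_nil, ← hn]
      omega
    links := by
      intro d d' v a₁ a₂ t t' h h'
      obtain ⟨d₀, h₀, h₁⟩ := hold d v (start_eq_some_iff.2 ⟨_, _, h⟩)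
      obtain ⟨d₀', h₀', h₁'⟩ := hold d' v (start_eq_some_iff.2 ⟨_, _, h'⟩)
      exact hE.trans h₁ (hE.trans (hD.eqvGen_of_start_eq hE hcorner h₀ h₀') (hE.symm h₁'))
    euler := by
      have := hD.euler
      change D.numVertices + _ = _
      rw [hlen, hc', List.length_cons]
      omega }

/-- The tip is a new vertex from which only `(n, false)` issues. Hypothesis `hne` excludes old edges
together with an empty boundary: then the new edge would share no corner with the old edges at its
origin. -/
theorem addSpur (hD : D.IsVanKampen R w) (hne : D.boundary = [] → D.edges = []) {wx wy : List α}
    {a : α} (hw : w = wx ++ wy) :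
    (D.addSpur wx.length a).IsVanKampen R (wx ++ a :: a⁻¹ :: wy) := by
  subst hw
  obtain ⟨x, y, hb, hx, hy⟩ := hD.boundary_label.exists_append
  rw [← hx.length_eq]
  set D' := D.addSpur x.length a with hD'
  set n := D.edges.length with hn
  have hb' : D'.boundary = x ++ (n, true) :: (n, false) :: y := by
    simp only [hD', Diagram.addSpur, hb]
    simp [hn]
  have he : D'.edges = D.edges ++ [(D.boundaryVertex x.length, a, D.numVertices)] := rfl
  have hdt := dart_new_true he
  have hdn := dart_new_false he
  rw [← hn] at hdt hdn
  have hst : D'.start (n, true) = some (D.boundaryVertex x.length) := by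
    rw [start, hdt]; rfl
  have hsn : D'.start (n, false) = some D.numVertices := by
    rw [start, hdn]; rfl
  have hs_lt := hD.boundaryVertex_lt hb
  have hlt : ∀ d ∈ D.boundary, d.1 < n := fun d hd => hD.boundary_label.lt hd
  have hcirc : D'.IsCircuit (x ++ (n, true) :: (n, false) :: y) := by
    rw [isCircuit_iff, Cycle.coe_append_comm x]
    refine (chain_turn_spur D'.equivalence_start_eq rfl
      (y ++ x)).2 ⟨fun d hd => ?_, ?_⟩
    · have hd' : d ∈ D.boundary := by
        have := List.mem_of_mem_head? hd
        rw [List.mem_append] at this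
        rw [hb, List.mem_append]
        exact this.symm
      rw [hst, start_of_edges_eq he (hlt d hd'), hD.start_head hb d hd]
    · rw [← Cycle.coe_append_comm x, ← hb, ← isCircuit_iff]
      exact hD.boundary_circuit.of_edges_eq he hlt
  have hE : Equivalence (EqvGen D'.Corner) := EqvGen.is_equivalence _
  have hchain := (chain_turn_spur hE (hE.refl _) (y ++ x)).1 (by
    have := D'.chain_eqvGen_corner (p := D'.boundary) (by simp)
    rwa [hb', Cycle.coe_append_comm] at this)
  have hcorner : ∀ d d', D.Corner d d' → EqvGen D'.Corner d d' := by
    refine corner_le_iff.2 fun p hp => ?_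
    rcases List.mem_cons.1 hp with rfl | hp
    · rw [hb, Cycle.coe_append_comm]
      exact hchain.2
    · exact D'.chain_eqvGen_corner (List.mem_cons_of_mem _ hp)
  have hlen : D'.edges.length = n + 1 := by simp [he, hn]
  have hcases : ∀ d v, D'.start d = some v → d = (n, false) ∧ v = D.numVertices ∨
      d = (n, true) ∧ v = D.boundaryVertex x.length ∨ D.start d = some v := by
    rintro ⟨i, b⟩ v hd
    have hi := lt_of_start_eq_some hd
    rw [hlen] at hi
    rcases Nat.lt_succ_iff_lt_or_eq.1 hi with hi | rfl
    · exact Or.inr (Or.inr (by rwa [start_of_edges_eq he hi] at hd))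
    · cases b with
      | true => exact Or.inr (Or.inl ⟨rfl, Option.some.inj (by rw [← hd, ← hst])⟩)
      | false => exact Or.inl ⟨rfl, Option.some.inj (by rw [← hd, ← hsn])⟩
  have htrue : ∀ d, D.start d = some (D.boundaryVertex x.length) →
      EqvGen D'.Corner (n, true) d := by
    intro d hd
    cases hyx : y ++ x with
    | nil =>
      obtain ⟨rfl, rfl⟩ := List.append_eq_nil_iff.1 hyx
      have := lt_of_start_eq_some hd
      rw [hne hb] at this
      exact absurd this (Nat.not_lt_zero _)
    | cons c l =>
      have hc : c ∈ (y ++ x).head? := by simp [hyx]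
      exact hE.trans (hchain.1 c hc)
        (hD.eqvGen_of_start_eq hE hcorner (hD.start_head hb c hc) hd)
  have hlinks : ∀ d d' v, D'.start d = some v → D'.start d' = some v →
      EqvGen D'.Corner d d' := by
    intro d d' v h h'
    rcases hcases d v h with ⟨rfl, rfl⟩ | ⟨rfl, rfl⟩ | h₀ <;>
      rcases hcases d' _ h' with ⟨rfl, hv⟩ | ⟨rfl, hv⟩ | h₀'
    · exact hE.refl _
    · exact absurd hv hs_lt.ne'
    · exact absurd (hD.start_lt h₀') (lt_irrefl _)
    · exact absurd hv hs_lt.ne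
    · exact hE.refl _
    · exact htrue _ h₀'
    · exact absurd (hD.start_lt h₀) (hv ▸ lt_irrefl _)
    · exact hE.symm (htrue _ (hv ▸ h₀))
    · exact hD.eqvGen_of_start_eq hE hcorner h₀ h₀'
  have hread : D'.Reads [(n, true), (n, false)] [a, a⁻¹] := by
    simp [Reads, hdt, hdn]
  exact
  { base_lt := Nat.lt_succ_of_lt hD.base_lt
    endpoints_lt := by
      intro e h
      rw [he, List.mem_append, List.mem_singleton] at h
      rcases h with h | rfl
      · exact ⟨Nat.lt_succ_of_lt (hD.endpoints_lt e h).1,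
          Nat.lt_succ_of_lt (hD.endpoints_lt e h).2⟩
      · exact ⟨Nat.lt_succ_of_lt hs_lt, Nat.lt_succ_self _⟩
    connected := by
      intro v hv
      rcases Nat.lt_succ_iff_lt_or_eq.1 hv with hv | rfl
      · exact hD.connected_of_edges_eq he rfl hv
      · exact (hD.connected_of_edges_eq he rfl hs_lt).tail ⟨_, _, dart_new_true he⟩
    cells_ne_nil := hD.cells_ne_nil
    cells_circuit := fun p hp =>
      (hD.cells_circuit p hp).of_edges_eq he fun d hd => hD.cells_lt hp hd
    cells_label := fun p hp =>
      let ⟨r, hr, hp⟩ := hD.cells_label p hp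
      ⟨r, hr, hp.of_edges_eq he⟩
    boundary_circuit := hb' ▸ hcirc
    boundary_base := by
      intro d hd
      change D'.start d = some D.base
      rw [hb'] at hd
      cases x with
      | nil =>
        obtain rfl : (n, true) = d := by simpa using hd
        rw [hst]
        cases y with
        | nil => simp [boundaryVertex, hb]
        | cons c y =>
          rw [← hD.start_head hb c (by simp)]
          exact hD.boundary_base c (by simp [hb])
      | cons c x =>
        obtain rfl : c = d := by simpa using hd
        rw [start_of_edges_eq he (hx.lt (by simp))]
        exact hD.boundary_base c (by simp [hb])
    boundary_label := by
      rw [hb']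
      exact (hx.of_edges_eq he).append (hread.append (hy.of_edges_eq he))
    sides := by
      intro d hd
      rw [hlen] at hd
      refine hD.count_of_perm ?_ hd
      change (D'.boundary ++ D.cells.flatten).Perm _
      rw [hb', hb, List.perm_iff_count]
      intro c
      simp only [List.count_append, List.count_cons, ← hn]
      omega
    links := fun d d' v a₁ a₂ t t' h h' =>
      hlinks d d' v (start_eq_some_iff.2 ⟨_, _, h⟩) (start_eq_some_iff.2 ⟨_, _, h'⟩)
    euler := by
      have := hD.euler
      change D.numVertices + 1 + D.cells.length = _
      rw [hlen]
      omega }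

end IsVanKampen

theorem isVanKampen_point (R : Set (List α)) : (point α).IsVanKampen R [] where
  base_lt := Nat.zero_lt_one
  endpoints_lt := by simp [point]
  connected := by
    intro v hv
    obtain rfl : v = 0 := Nat.lt_one_iff.1 hv
    exact ReflTransGen.refl
  cells_ne_nil := by simp [point]
  cells_circuit := by simp [point]
  cells_label := by simp [point]
  boundary_circuit := by simp [isCircuit_iff, point]
  boundary_base := by simp [point]
  boundary_label := by simp [point, Reads]
  sides := by simp [point]
  links := by
    intro d d' v a a' t t' h
    exact absurd (lt_of_dart_eq_some h) (Nat.not_lt_zero _)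
  euler := rfl

end Diagram

/-! ### Induction along a stacking -/

namespace SymmGenSet

variable {G : Type u} [Group G] (A : SymmGenSet G)

theorem eval_nil : A.eval [] = 1 := rfl

theorem eval_cons (a : A.Letter) (w : List A.Letter) : A.eval (a :: w) = a.val * A.eval w := by
  simp [eval]

theorem eval_append (w z : List A.Letter) : A.eval (w ++ z) = A.eval w * A.eval z := by
  simp [eval]

theorem Letter.val_inv {A : SymmGenSet G} (a : A.Letter) : (a⁻¹).val = a.val⁻¹ := rfl

theorem Letter.inv_inv {A : SymmGenSet G} (a : A.Letter) : a⁻¹⁻¹ = a :=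
  Subtype.ext (_root_.inv_inv (a.val))

theorem Letter.val_ne_one {A : SymmGenSet G} (a : A.Letter) : a.val ≠ 1 := fun h =>
  A.one_notMem (h ▸ a.property)

theorem Letter.val_injective {A : SymmGenSet G} :
    Function.Injective (Letter.val : A.Letter → G) :=
  Subtype.val_injective

/-- Applied with `w = c e`, it transports a property across a recursive edge once it passes along
the edges of the path `c e`. -/
theorem induction_along_path {A : SymmGenSet G} {Q : G → Prop} {w : List A.Letter} {g : G}
    (h : ∀ e, LiesOnPath e g w → Q e.1 → Q (e.1 * e.2.val)) (hg : Q g) : Q (g * A.eval w) := by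
  induction w generalizing g with
  | nil => simpa [eval_nil] using hg
  | cons b w ih =>
    rw [eval_cons, ← mul_assoc]
    refine ih ?_ (h (g, b) ⟨[], w, b, rfl, by simp [eval_nil]⟩ hg)
    rintro _ ⟨x, z, c, rfl, rfl⟩
    exact h _ ⟨b :: x, z, c, rfl, by simp [eval_cons, mul_assoc]⟩

end SymmGenSet

namespace Stacking

variable {G : Type u} [Group G] {A : SymmGenSet G} (S : Stacking A)

/-- The number of predecessors is finite and strictly increases along `<_c`. -/
theorem wellFounded_stackingLT : WellFounded (StackingLT S.c) := by
  have := S.strictOrder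
  refine Subrelation.wf (r := InvImage (· < ·) fun e => {e' | StackingLT S.c e' e}.ncard) ?_
    (InvImage.wf _ Nat.lt_wfRel.wf)
  intro e e' h
  refine Set.ncard_lt_ncard ?_ (S.finite_below e')
  refine ⟨fun d hd => _root_.trans hd h, fun hle => ?_⟩
  exact irrefl_of (StackingLT S.c) e (hle h)

/-- Induction on the edges of the Cayley graph. -/
theorem edge_induction {P : G × A.Letter → Prop} (hdeg : ∀ e, IsDegenerate S.nf e → P e)
    (hrec : ∀ e : RecursiveEdge S.nf, (∀ e', LiesOnPath e' e.1.1 (S.c e) → P e') → P e.1)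
    (e : G × A.Letter) : P e := by
  by_cases he : IsDegenerate S.nf e
  · exact hdeg e he
  · refine S.wellFounded_stackingLT.induction (C := fun e => P e.1)
      (⟨e, he⟩ : RecursiveEdge S.nf) fun d ih => hrec d fun e' he' => ?_
    by_cases h : IsDegenerate S.nf e'
    · exact hdeg e' h
    · exact ih ⟨e', h⟩ (TransGen.single he')

/-- The set of normal forms is closed under prefixes. -/
theorem nf_eval_of_append_eq {g : G} {x y : List A.Letter} (h : S.nf g = x ++ y) :
    S.nf (A.eval x) = x := by
  -- "All prefixes of the normal form of `g` are normal forms" holds at the identity and passes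
  -- along every edge: at a degenerate edge the two normal forms differ by one last letter, and a
  -- recursive edge is replaced by its path.
  let Q : G → Prop := fun g => ∀ x y, S.nf g = x ++ y → S.nf (A.eval x) = x
  have hQ : ∀ e : G × A.Letter, Q e.1 → Q (e.1 * e.2.val) := by
    refine S.edge_induction ?_ ?_
    · rintro ⟨g, a⟩ (hd | hd) hg x y hxy
      · rcases List.eq_nil_or_concat' y with rfl | ⟨y, b, rfl⟩
        · rw [List.append_nil] at hxy
          rw [← hxy, S.eval_nf]
        · rw [← hd, ← List.append_assoc] at hxy
          exact hg x y (List.append_inj' hxy rfl).1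
      · exact hg x (y ++ [a⁻¹]) (by rw [hd, hxy, List.append_assoc])
    · intro e ih hg
      rw [← S.eval_c]
      exact SymmGenSet.induction_along_path ih hg
  have h1 : Q 1 := by
    intro x y hxy
    rw [S.nf_one] at hxy
    obtain ⟨rfl, -⟩ := List.append_eq_nil_iff.1 hxy.symm
    exact S.nf_one
  have hg : Q g := by
    have := SymmGenSet.induction_along_path (w := S.nf g) (fun e _ => hQ e) h1
    rwa [S.eval_nf, one_mul] at this
  exact hg x y h

theorem eval_extendedMap (e : G × A.Letter) : A.eval (S.extendedMap e) = e.2.val := by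
  unfold extendedMap
  split_ifs with h
  · simp [SymmGenSet.eval]
  · exact S.eval_c _

/-- A recursive edge with `c e = [a]` would lie on its own path, against irreflexivity. Thus the
procedure can recognize degenerate edges from `c'` alone. -/
theorem extendedMap_eq_singleton_iff (e : G × A.Letter) :
    S.extendedMap e = [e.2] ↔ IsDegenerate S.nf e := by
  unfold extendedMap
  split_ifs with h
  · simp [h]
  · simp only [h, iff_false]
    intro hc
    have := S.strictOrder
    refine irrefl_of (StackingLT S.c) ⟨e, h⟩ (TransGen.single ⟨[], [], e.2, hc, ?_⟩)
    simp [SymmGenSet.eval_nil]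

theorem extendedMap_ne_nil (e : G × A.Letter) : S.extendedMap e ≠ [] := fun h =>
  e.2.val_ne_one (by rw [← S.eval_extendedMap e, h, SymmGenSet.eval_nil])

theorem append_inv_mem_relators {e : G × A.Letter} (he : S.extendedMap e ≠ [e.2]) :
    S.extendedMap e ++ [e.2⁻¹] ∈ S.relators := by
  rw [Ne, S.extendedMap_eq_singleton_iff] at he
  refine ⟨by simp, .base _ ⟨⟨e, he⟩, ?_⟩⟩
  simp [extendedMap, he]

/-! ### Reduction of words to normal form -/

/-- A state `(s, u, l)` of the reduction procedure: the reverse of a normal form `s`, the word `u`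
that remains to be read, and a list `l` recording the steps made so far, the latest first. A step
is recorded as `(i, a, none)` if a subword `a a⁻¹` was deleted at position `i`, and as
`(i, a, some k)` if the letter `a` at position `i` was replaced by a word of length `k`. -/
abbrev State (α : Type u) : Type u := List α × List α × List (ℕ × α × Option ℕ)

open Classical in
/-- The step of the reduction procedure at the letter `a`, mapped to `v` by the extended stacking
map. -/
noncomputable def advance (s : List A.Letter) (a : A.Letter) (u : List A.Letter)
    (l : List (ℕ × A.Letter × Option ℕ)) (v : List A.Letter) : State A.Letter :=
  if v = [a] then
    if s.head? = some a⁻¹ then (s.tail, u, (s.tail.length, a⁻¹, none) :: l) else (a :: s, u, l)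
  else (s, v ++ u, (s.length, a, some v.length) :: l)

/-- The step function of the reduction procedure. -/
noncomputable def step (st : State A.Letter) : State A.Letter :=
  match st with
  | (s, [], l) => (s, [], l)
  | (s, a :: u, l) => advance s a u l (S.extendedMap (A.eval s.reverse, a))

/-- Iteration of the step function. -/
def Run : State A.Letter → State A.Letter → Prop := ReflTransGen fun x y => S.step x = y

theorem exists_run_of_liesOnPath {g : G} {w : List A.Letter}
    (h : ∀ e, LiesOnPath e g w → ∀ u l, ∃ l',
      S.Run ((S.nf e.1).reverse, e.2 :: u, l) ((S.nf (e.1 * e.2.val)).reverse, u, l'))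
    (u : List A.Letter) (l : List (ℕ × A.Letter × Option ℕ)) :
    ∃ l', S.Run ((S.nf g).reverse, w ++ u, l) ((S.nf (g * A.eval w)).reverse, u, l') := by
  induction w generalizing g l with
  | nil => exact ⟨l, by simpa [SymmGenSet.eval_nil, Run] using ReflTransGen.refl⟩
  | cons b w ih =>
    obtain ⟨l₁, h₁⟩ := h (g, b) ⟨[], w, b, rfl, by simp [SymmGenSet.eval_nil]⟩ (w ++ u) l
    obtain ⟨l₂, h₂⟩ := ih (g := g * b.val) (by
      rintro _ ⟨x, z, c, rfl, rfl⟩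
      exact h _ ⟨b :: x, z, c, rfl, by simp [SymmGenSet.eval_cons, mul_assoc]⟩) l₁
    refine ⟨l₂, h₁.trans ?_⟩
    rwa [SymmGenSet.eval_cons, ← mul_assoc]

/-- At a recursive edge one step puts `c e` in place of the letter, and the runs across the smaller
edges of that path are concatenated. The unread word `u` and the record `l` are arbitrary to allow
this. -/
theorem exists_run_edge (e : G × A.Letter) : ∀ u l, ∃ l',
    S.Run ((S.nf e.1).reverse, e.2 :: u, l) ((S.nf (e.1 * e.2.val)).reverse, u, l') := by
  refine S.edge_induction (P := fun e => ∀ u l, ∃ l', S.Run ((S.nf e.1).reverse, e.2 :: u, l)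
    ((S.nf (e.1 * e.2.val)).reverse, u, l')) ?_ ?_ e
  · rintro ⟨g, a⟩ hd u l
    have hv : S.extendedMap (A.eval (S.nf g).reverse.reverse, a) = [a] := by
      rw [List.reverse_reverse, S.eval_nf]
      exact (S.extendedMap_eq_singleton_iff _).2 hd
    by_cases hs : (S.nf g).reverse.head? = some a⁻¹
    · obtain ⟨z, hz⟩ : ∃ z, S.nf g = z ++ [a⁻¹] := by
        rcases List.eq_nil_or_concat' (S.nf g) with h | ⟨z, b, h⟩
        · simp [h] at hs
        · obtain rfl : b = a⁻¹ := by simpa [h] using hs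
          exact ⟨z, h⟩
      -- By prefix closure cancelling is right whenever the normal form ends in `a⁻¹`, whichever
      -- alternative made the edge degenerate.
      have hz' : S.nf (g * a.val) = z := by
        have hg : g = A.eval z * a.val⁻¹ := by
          rw [← S.eval_nf g, hz, SymmGenSet.eval_append, SymmGenSet.eval_cons,
            SymmGenSet.eval_nil, mul_one, SymmGenSet.Letter.val_inv]
        rw [hg, inv_mul_cancel_right]
        exact S.nf_eval_of_append_eq hz
      refine ⟨(z.length, a⁻¹, none) :: l, ReflTransGen.single ?_⟩
      simp only [step, hv, advance, if_true, hs, hz']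
      simp [hz]
    · have hg : S.nf g ++ [a] = S.nf (g * a.val) := by
        rcases hd with hd | hd
        · exact hd
        · exact absurd (by simp [show S.nf g = _ from hd]) hs
      refine ⟨l, ReflTransGen.single ?_⟩
      simp only [step, hv, advance, if_true, hs, if_false, ← hg]
      simp
  · intro e ih u l
    have hv : S.extendedMap (A.eval (S.nf e.1.1).reverse.reverse, e.1.2) = S.c e := by
      rw [List.reverse_reverse, S.eval_nf, extendedMap, dif_neg e.2]
      rfl
    have hne : S.c e ≠ [e.1.2] := fun h => e.2 <| by
      rw [← S.extendedMap_eq_singleton_iff, ← h, ← hv, List.reverse_reverse, S.eval_nf]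
    obtain ⟨l', h⟩ := S.exists_run_of_liesOnPath ih u
      (((S.nf e.1.1).reverse.length, e.1.2, some (S.c e).length) :: l)
    rw [S.eval_c] at h
    refine ⟨l', ReflTransGen.head ?_ h⟩
    simp only [step, hv, advance, hne, if_false]

theorem exists_run (w : List A.Letter) :
    ∃ l, S.Run ([], w, []) ((S.nf (A.eval w)).reverse, [], l) := by
  obtain ⟨l, h⟩ := S.exists_run_of_liesOnPath (g := 1) (w := w)
    (fun e _ => S.exists_run_edge e) [] []
  exact ⟨l, by simpa [S.nf_one] using h⟩

theorem Run.exists_iterate {S : Stacking A} {x y : State A.Letter} (h : S.Run x y) :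
    ∃ k, S.step^[k] x = y := by
  induction h with
  | refl => exact ⟨0, rfl⟩
  | tail _ h ih =>
    obtain ⟨k, rfl⟩ := ih
    exact ⟨k + 1, by rw [Function.iterate_succ_apply', h]⟩

theorem run_iterate (k : ℕ) (x : State A.Letter) : S.Run x (S.step^[k] x) := by
  induction k with
  | zero => exact ReflTransGen.refl
  | succ k ih => exact ih.tail (Function.iterate_succ_apply' _ _ _).symm

theorem iterate_step_of_done (k : ℕ) {st : State A.Letter} (h : st.2.1 = []) :
    S.step^[k] st = st := by
  obtain ⟨s, u, l⟩ := st
  obtain rfl : u = [] := h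
  exact Function.iterate_fixed rfl k

theorem exists_done (w : List A.Letter) : ∃ k, (S.step^[k] ([], w, [])).2.1 = [] := by
  obtain ⟨l, h⟩ := S.exists_run w
  obtain ⟨k, hk⟩ := h.exists_iterate
  exact ⟨k, by rw [hk]⟩

open Classical in
/-- The final state of the reduction procedure for the word `w`. -/
noncomputable def finalState (w : List A.Letter) : State A.Letter :=
  S.step^[Nat.find (S.exists_done w)] ([], w, [])

open Classical in
theorem finalState_done (w : List A.Letter) : (S.finalState w).2.1 = [] :=
  Nat.find_spec (S.exists_done w)

/-- Finished states are fixed by `step`, so the least stopping time and the one from `exists_run`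
lead to the same state. -/
theorem finalState_fst (w : List A.Letter) :
    (S.finalState w).1 = (S.nf (A.eval w)).reverse := by
  classical
  obtain ⟨l, h⟩ := S.exists_run w
  obtain ⟨k, hk⟩ := h.exists_iterate
  have h₁ : S.step^[k] (S.finalState w) = S.finalState w :=
    S.iterate_step_of_done k (S.finalState_done w)
  rw [← h₁, finalState, ← Function.iterate_add_apply, add_comm, Function.iterate_add_apply, hk,
    S.iterate_step_of_done _ rfl]

theorem finalState_fst_eq_nil_iff (w : List A.Letter) :
    (S.finalState w).1 = [] ↔ A.eval w = 1 := by
  rw [finalState_fst, List.reverse_eq_nil_iff]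
  constructor
  · intro h
    rw [← S.eval_nf (A.eval w), h, SymmGenSet.eval_nil]
  · intro h
    rw [h, S.nf_one]

end Stacking

/-! ### The van Kampen diagram recorded by a reduction -/

/-- Undo a recorded step of the reduction procedure in a diagram. -/
def Diagram.undo {α : Type u} [Inv α] (D : Diagram α) (m : ℕ × α × Option ℕ) : Diagram α :=
  m.2.2.elim (D.addSpur m.1 m.2.1) fun k => D.addChord m.1 k m.2.1

/-- The diagram obtained from a list of recorded steps, the latest first. -/
def Diagram.ofMoves {α : Type u} [Inv α] (l : List (ℕ × α × Option ℕ)) : Diagram α :=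
  l.foldl Diagram.undo (Diagram.point α)

namespace Stacking

variable {G : Type u} [Group G] {A : SymmGenSet G} (S : Stacking A)

/-- Induction from the end of the run backwards, the current word being `s.reverse ++ u`. Moving a
letter from `u` to `s` leaves this word unchanged. The last conjunct supplies the side condition of
`addSpur`. -/
theorem Run.exists_isVanKampen {S : Stacking A} {st st' : State A.Letter} (h : S.Run st st')
    (hs : st'.1 = []) (hu : st'.2.1 = []) :
    ∃ l, st'.2.2 = l ++ st.2.2 ∧
      (Diagram.ofMoves l).IsVanKampen S.relators (st.1.reverse ++ st.2.1) ∧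
      ((Diagram.ofMoves l).boundary = [] → (Diagram.ofMoves l).edges = []) := by
  induction h using ReflTransGen.head_induction_on with
  | refl =>
    refine ⟨[], rfl, ?_, fun _ => rfl⟩
    rw [hs, hu]
    exact Diagram.isVanKampen_point _
  | @head st st₁ h _ ih =>
    obtain ⟨l, hl, hD, hne⟩ := ih
    subst h
    obtain ⟨s, _ | ⟨a, u⟩, l₀⟩ := st
    · exact ⟨l, hl, hD, hne⟩
    · generalize hv : S.extendedMap (A.eval s.reverse, a) = v at *
      have hstep : S.step (s, a :: u, l₀) = advance s a u l₀ v := by rw [step, hv]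
      rw [hstep] at hl hD
      unfold advance at hl hD
      split_ifs at hl hD with hva hsa
      · obtain ⟨s, rfl⟩ : ∃ z, s = a⁻¹ :: z := by
          cases s with
          | nil => simp at hsa
          | cons b z => exact ⟨z, by simpa using hsa⟩
        refine ⟨l ++ [(s.length, a⁻¹, none)], by simpa using hl, ?_, ?_⟩
        · have := hD.addSpur hne (a := a⁻¹) rfl
          rw [SymmGenSet.Letter.inv_inv, List.length_reverse] at this
          simpa [Diagram.ofMoves, Diagram.undo] using this
        · simp [Diagram.ofMoves, Diagram.undo, Diagram.addSpur]
      · exact ⟨l, hl, by simpa using hD, hne⟩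
      · refine ⟨l ++ [(s.length, a, some v.length)], by simpa using hl, ?_, ?_⟩
        · have := hD.addChord (wx := s.reverse) (wv := v) (wy := u) (a := a) (by simp)
            (hv ▸ S.extendedMap_ne_nil _)
            (by
              rw [← hv]
              exact S.append_inv_mem_relators (e := (A.eval s.reverse, a)) (by rwa [hv]))
          rw [List.length_reverse] at this
          simpa [Diagram.ofMoves, Diagram.undo] using this
        · simp [Diagram.ofMoves, Diagram.undo, Diagram.addChord]

theorem isVanKampen_ofMoves_finalState {w : List A.Letter} (hw : A.eval w = 1) :
    (Diagram.ofMoves (S.finalState w).2.2).IsVanKampen S.relators w := by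
  classical
  obtain ⟨l, hl, hD, -⟩ :=
    (S.run_iterate (Nat.find (S.exists_done w)) ([], w, [])).exists_isVanKampen
    ((S.finalState_fst_eq_nil_iff w).2 hw) (S.finalState_done w)
  rw [List.append_nil] at hl
  rw [finalState, hl]
  simpa using hD

end Stacking

/-! ### Computability of the operations on diagrams -/

namespace Diagram

variable {α : Type u} [Primcodable α]

theorem primrec_equivTuple : Primrec (equivTuple α) := Primrec.of_equiv

theorem primrec_equivTuple_symm : Primrec (equivTuple α).symm := Primrec.of_equiv_symm

theorem primrec_numVertices : Primrec (numVertices : Diagram α → ℕ) :=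
  Primrec.fst.comp primrec_equivTuple

theorem primrec_base : Primrec (base : Diagram α → ℕ) :=
  (Primrec.fst.comp Primrec.snd).comp primrec_equivTuple

theorem primrec_edges : Primrec (edges : Diagram α → List (ℕ × α × ℕ)) :=
  (Primrec.fst.comp (Primrec.snd.comp Primrec.snd)).comp primrec_equivTuple

theorem primrec_cells : Primrec (cells : Diagram α → List (List (ℕ × Bool))) :=
  (Primrec.fst.comp (Primrec.snd.comp (Primrec.snd.comp Primrec.snd))).comp primrec_equivTuple

theorem primrec_boundary : Primrec (boundary : Diagram α → List (ℕ × Bool)) :=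
  (Primrec.snd.comp (Primrec.snd.comp (Primrec.snd.comp Primrec.snd))).comp primrec_equivTuple

theorem primrec_mk {β : Type*} [Primcodable β] {f g : β → ℕ} {e : β → List (ℕ × α × ℕ)}
    {c : β → List (List (ℕ × Bool))} {b : β → List (ℕ × Bool)} (hf : Primrec f) (hg : Primrec g)
    (he : Primrec e) (hc : Primrec c) (hb : Primrec b) :
    Primrec fun x => (⟨f x, g x, e x, c x, b x⟩ : Diagram α) :=
  primrec_equivTuple_symm.comp (hf.pair (hg.pair (he.pair (hc.pair hb))))

variable [Inv α] [Finite α]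

theorem primrec₂_dart : Primrec₂ (dart : Diagram α → ℕ × Bool → Option (ℕ × α × ℕ)) := by
  have hget : Primrec fun p : Diagram α × ℕ × Bool => p.1.edges[p.2.1]? :=
    Primrec.list_getElem?.comp (primrec_edges.comp Primrec.fst) (Primrec.fst.comp Primrec.snd)
  have hinv : Primrec (fun a : α => a⁻¹) := Primrec.dom_finite _
  have hflip : Primrec fun e : ℕ × α × ℕ => (e.2.2, e.2.1⁻¹, e.1) :=
    (Primrec.snd.comp Primrec.snd).pair
      ((hinv.comp (Primrec.fst.comp Primrec.snd)).pair Primrec.fst)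
  refine (Primrec.cond (Primrec.snd.comp Primrec.snd) hget
    (Primrec.option_map hget (hflip.comp Primrec.snd).to₂)).of_eq ?_
  rintro ⟨D, i, b⟩
  cases b <;> rfl

theorem primrec₂_boundaryVertex : Primrec₂ (boundaryVertex : Diagram α → ℕ → ℕ) := by
  have hstart : Primrec₂ (start : Diagram α → ℕ × Bool → Option ℕ) :=
    Primrec.option_map primrec₂_dart (Primrec.fst.comp Primrec.snd).to₂
  exact Primrec.option_getD.comp
    (Primrec.option_bind
      (Primrec.list_getElem?.comp (primrec_boundary.comp Primrec.fst) Primrec.snd)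
      (hstart.comp (Primrec.fst.comp Primrec.fst) Primrec.snd).to₂)
    (primrec_base.comp Primrec.fst)

section

variable {β : Type*} [Primcodable β] {D : β → Diagram α} {i k : β → ℕ} {a : β → α}

theorem primrec_addSpur (hD : Primrec D) (hi : Primrec i) (ha : Primrec a) :
    Primrec fun x => (D x).addSpur (i x) (a x) := by
  have hV := primrec_numVertices.comp hD
  have hB := primrec_boundary.comp hD
  have hn := Primrec.list_length.comp (primrec_edges.comp hD)
  exact primrec_mk (Primrec.succ.comp hV) (primrec_base.comp hD)
    (Primrec.list_append.comp (primrec_edges.comp hD) (Primrec.list_cons.comp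
      ((primrec₂_boundaryVertex.comp hD hi).pair (ha.pair hV)) (Primrec.const [])))
    (primrec_cells.comp hD)
    (Primrec.list_append.comp (Primrec.list_take.comp hi hB)
      (Primrec.list_cons.comp (hn.pair (Primrec.const true))
        (Primrec.list_cons.comp (hn.pair (Primrec.const false)) (Primrec.list_drop.comp hi hB))))

theorem primrec_addChord (hD : Primrec D) (hi : Primrec i) (hk : Primrec k) (ha : Primrec a) :
    Primrec fun x => (D x).addChord (i x) (k x) (a x) := by
  have hB := primrec_boundary.comp hD
  have hn := Primrec.list_length.comp (primrec_edges.comp hD)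
  have hik := Primrec.nat_add.comp hi hk
  exact primrec_mk (primrec_numVertices.comp hD) (primrec_base.comp hD)
    (Primrec.list_append.comp (primrec_edges.comp hD) (Primrec.list_cons.comp
      ((primrec₂_boundaryVertex.comp hD hi).pair
        (ha.pair (primrec₂_boundaryVertex.comp hD hik))) (Primrec.const [])))
    (Primrec.list_cons.comp
      (Primrec.list_append.comp (Primrec.list_take.comp hk (Primrec.list_drop.comp hi hB))
        (Primrec.list_cons.comp (hn.pair (Primrec.const false)) (Primrec.const [])))
      (primrec_cells.comp hD))
    (Primrec.list_append.comp (Primrec.list_take.comp hi hB)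
      (Primrec.list_cons.comp (hn.pair (Primrec.const true)) (Primrec.list_drop.comp hik hB)))

end

theorem primrec₂_undo :
    Primrec₂ (undo : Diagram α → ℕ × α × Option ℕ → Diagram α) := by
  have hi : Primrec fun p : Diagram α × ℕ × α × Option ℕ => p.2.1 :=
    Primrec.fst.comp Primrec.snd
  have ha : Primrec fun p : Diagram α × ℕ × α × Option ℕ => p.2.2.1 :=
    Primrec.fst.comp (Primrec.snd.comp Primrec.snd)
  refine (Primrec.option_casesOn (Primrec.snd.comp (Primrec.snd.comp Primrec.snd))
    (primrec_addSpur Primrec.fst hi ha)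
    (primrec_addChord (Primrec.fst.comp Primrec.fst) (hi.comp Primrec.fst) Primrec.snd
      (ha.comp Primrec.fst)).to₂).of_eq ?_
  rintro ⟨D, i, a, _ | k⟩ <;> rfl

theorem primrec_ofMoves :
    Primrec (ofMoves : List (ℕ × α × Option ℕ) → Diagram α) :=
  Primrec.list_foldl Primrec.id (Primrec.const _)
    (primrec₂_undo.comp (Primrec.fst.comp Primrec.snd) (Primrec.snd.comp Primrec.snd)).to₂

end Diagram

/-! ### Computability of the reduction procedure -/

theorem ComputablePred.comp {α β : Type*} [Primcodable α] [Primcodable β] {p : β → Prop}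
    (hp : ComputablePred p) {f : α → β} (hf : Computable f) : ComputablePred fun a => p (f a) :=
  let ⟨inst, h⟩ := hp
  ⟨fun a => inst (f a), h.comp hf⟩

/-- A function with decidable graph is computable. -/
theorem Computable.of_computablePred_graph {α β : Type*} [Primcodable α] [Primcodable β]
    {f : α → β} (h : ComputablePred fun p : α × β => p.2 = f p.1) : Computable f := by
  classical
  -- The value is found by searching all codes; numbers that code nothing are rejected.
  have hdec : ComputablePred fun p : α × ℕ => Encodable.decode (α := β) p.2 = some (f p.1) := by
    refine Computable.computablePred ((Computable.option_casesOn (Computable.decode.comp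
      Computable.snd) (Computable.const false) (h.decide.comp
        ((Computable.fst.comp Computable.fst).pair Computable.snd)).to₂).of_eq ?_)
    rintro ⟨a, n⟩
    cases Encodable.decode (α := β) n <;> simp
  have hex (a : α) : ∃ n, Encodable.decode (α := β) n = some (f a) :=
    ⟨Encodable.encode (f a), Encodable.encodek _⟩
  refine Computable.option_some_iff.1 ((Computable.decode.comp (Computable.find
    (P := fun a n => Encodable.decode (α := β) n = some (f a)) hdec hex)).of_eq fun a => ?_)
  exact Nat.find_spec (hex a)

theorem Computable.iterate {α β : Type*} [Primcodable α] [Primcodable β] {k : α → ℕ} {f : β → β}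
    {g : α → β} (hk : Computable k) (hf : Computable f) (hg : Computable g) :
    Computable fun a => f^[k a] (g a) := by
  refine (Computable.nat_rec hk hg
    (hf.comp (Computable.snd.comp Computable.snd)).to₂).of_eq fun a => ?_
  generalize k a = n
  induction n with
  | zero => rfl
  | succ n ih => rw [Function.iterate_succ_apply', ← ih]

instance SymmGenSet.finite_letter {G : Type u} [Group G] (A : SymmGenSet G) : Finite A.Letter :=
  inferInstanceAs (Finite {a : G // a ∈ A.carrier})

namespace Stacking

variable {G : Type u} [Group G] {A : SymmGenSet G} {S : Stacking A}

theorem computable_extendedMap (hS : S.IsAlgorithmic) :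
    Computable fun p : List A.Letter × A.Letter => S.extendedMap (A.eval p.1, p.2) :=
  Computable.of_computablePred_graph (hS.comp
    ((Computable.fst.comp Computable.fst).pair
      ((Computable.snd.comp Computable.fst).pair Computable.snd)))

theorem computablePred_eq_nil (α : Type*) [Primcodable α] :
    ComputablePred fun l : List α => l = [] := by
  classical
  exact (Primrec.eq.comp Primrec.id (Primrec.const [])).computablePred

open Primrec in
-- The letter is passed separately and the unread word is a tail because `computable_step`
-- distinguishes cases by `head?`. The value of `c'` is an argument, so everything else in a step is
-- primitive recursive.
theorem primrec_advance : Primrec fun p : (State A.Letter × A.Letter) × List A.Letter =>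
    advance p.1.1.1 p.1.2 p.1.1.2.1.tail p.1.1.2.2 p.2 := by
  classical
  have hst : Primrec fun p : (State A.Letter × A.Letter) × List A.Letter => p.1.1 :=
    fst.comp fst
  have hs := fst.comp hst
  have ha : Primrec fun p : (State A.Letter × A.Letter) × List A.Letter => p.1.2 :=
    snd.comp fst
  have hu := list_tail.comp (fst.comp (snd.comp hst))
  have hl := snd.comp (snd.comp hst)
  have hv : Primrec fun p : (State A.Letter × A.Letter) × List A.Letter => p.2 := snd
  have hinv : Primrec fun a : A.Letter => a⁻¹ := dom_finite _
  have hai := hinv.comp ha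
  have htail := list_tail.comp hs
  exact Primrec.ite (Primrec.eq.comp hv (list_cons.comp ha (const [])))
    (Primrec.ite (Primrec.eq.comp (list_head?.comp hs) (option_some.comp hai))
      (htail.pair (hu.pair (list_cons.comp
        ((list_length.comp htail).pair (hai.pair (const none))) hl)))
      ((list_cons.comp ha hs).pair (hu.pair hl)))
    (hs.pair ((list_append.comp hv hu).pair (list_cons.comp
      ((list_length.comp hs).pair (ha.pair (option_some.comp (list_length.comp hv)))) hl)))

theorem computable_step (hS : S.IsAlgorithmic) : Computable S.step := by
  have hs : Computable fun p : State A.Letter × A.Letter => p.1.1 :=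
    Computable.fst.comp Computable.fst
  have hsa : Computable fun p : State A.Letter × A.Letter => (p.1.1.reverse, p.2) :=
    (Computable.list_reverse.comp hs).pair Computable.snd
  have hv := (computable_extendedMap hS).comp hsa
  have hadv := primrec_advance.to_comp.comp (Computable.id.pair hv)
  have hhead : Computable fun st : State A.Letter => st.2.1.head? :=
    Primrec.list_head?.to_comp.comp (Computable.fst.comp Computable.snd)
  have hcases := Computable.option_casesOn hhead Computable.id (Computable.to₂ hadv)
  refine hcases.of_eq fun st => ?_
  obtain ⟨s, _ | ⟨a, u⟩, l⟩ := st
  · rfl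
  · simp only [List.head?_cons, step, id_eq, List.tail_cons]

/-- The stopping time is found by unbounded search, which succeeds for every word, trivial in `G` or
not. -/
theorem computable_finalState (hS : S.IsAlgorithmic) : Computable S.finalState := by
  classical
  have hinit : Computable fun w : List A.Letter => (([], w, []) : State A.Letter) :=
    (Computable.const []).pair (Computable.id.pair (Computable.const []))
  have hit : Computable fun p : List A.Letter × ℕ => S.step^[p.2] ([], p.1, []) :=
    Computable.iterate Computable.snd (computable_step hS) (hinit.comp Computable.fst)
  have hdone : ComputablePred fun p : List A.Letter × ℕ =>
      (S.step^[p.2] ([], p.1, [])).2.1 = [] :=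
    (computablePred_eq_nil _).comp ((Computable.fst.comp Computable.snd).comp hit)
  exact Computable.iterate (Computable.find hdone S.exists_done) (computable_step hS) hinit

theorem computablePred_eval_eq_one (hS : S.IsAlgorithmic) :
    ComputablePred fun w : List A.Letter => A.eval w = 1 :=
  ((computablePred_eq_nil _).comp (Computable.fst.comp (computable_finalState hS))).of_eq
    S.finalState_fst_eq_nil_iff

end Stacking

/-! ### The word problem and the main theorem. -/

theorem SymmGenSet.group_fg {G : Type u} [Group G] (A : SymmGenSet G) : Group.FG G :=
  ⟨⟨A.carrier, A.closure_eq_top⟩⟩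

theorem AlgorithmicallyStackable.hasSolvableWordProblem {G : Type u} [Group G]
    (h : AlgorithmicallyStackable G) : HasSolvableWordProblem G := by
  obtain ⟨A, S, hS⟩ := h
  refine ⟨A.group_fg, fun n g _ => ?_⟩
  -- Rewrites the given generators in the letters of `A`; a finite table is computable however its
  -- entries were chosen.
  let τ : Fin n × Bool → List A.Letter := fun p => S.nf (if p.2 then g p.1 else (g p.1)⁻¹)
  have hτ : Computable fun w : List (Fin n × Bool) => w.flatMap τ :=
    (Primrec.list_flatMap Primrec.id ((Primrec.dom_finite τ).comp Primrec.snd).to₂).to_comp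
  refine ((Stacking.computablePred_eval_eq_one hS).comp hτ).of_eq fun w => ?_
  have heval : A.eval (w.flatMap τ) =
      (w.map fun p => if p.2 then g p.1 else (g p.1)⁻¹).prod := by
    induction w with
    | nil => rfl
    | cons p w ih =>
      rw [List.flatMap_cons, SymmGenSet.eval_append, ih, List.map_cons, List.prod_cons,
        S.eval_nf]
  rw [heval]

theorem mainTheorem11 (G : Type u) [Group G] :
    (AlgorithmicallyStackable G → HasSolvableWordProblem G) ∧
    ∀ (A : SymmGenSet G) (S : Stacking A), S.IsAlgorithmic →
      ∃ construct : List A.Letter → Diagram A.Letter, Computable construct ∧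
        ∀ w : List A.Letter, A.eval w = 1 →
          (construct w).IsVanKampen S.relators w :=
  ⟨AlgorithmicallyStackable.hasSolvableWordProblem, fun _ S hS =>
    ⟨fun w => Diagram.ofMoves (S.finalState w).2.2,
      Diagram.primrec_ofMoves.to_comp.comp
        ((Computable.snd.comp Computable.snd).comp (Stacking.computable_finalState hS)),
      fun _ hw => S.isVanKampen_ofMoves_finalState hw⟩⟩
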